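/- Let $K\ge 2$ and let $p_1,\dots,p_K$ be probability mass functions on finite alphabets $\mathcal X_1,\dots,\mathcal X_K$. For a mass function $p$ on a finite alphabet $\mathcal Y$ write $H(p)=-\sum_{y\in\mathcal Y}p(y)\log p(y)$ (natural logarithm, $0\log 0=0$), and put $H_i=H(p_i)$ and $\Delta_i=\max_j H_j-H_i$. Source (arm) $i$ is memoryless: at each round $t=1,2,\dots$ it emits a symbol $X_i(t)$ with law $p_i$, independent of everything that happened before round $t$. At round $t$ a player, who knows the alphabet sizes but not the $p_i$, chooses an arm $I(t)$ on the basis of the past and observes $X_{I(t)}(t)$. Let $N_i(t)=\sum_{\tau=1}^t\mathbf 1[I(\tau)=i]$ and define the pseudo-regret $$R(t)=t\cdot\max_jH_j-\sum_{i=1}^K\mathbb E[N_i(t)]\,H_i .$$ Fix $\alpha>2$. Suppose that the player runs the upper-confidence-bound algorithm: at every round $t\ge1$, $I(t)$ is an arm $i$ (ties broken arbitrarily on the basis of the past and, possibly, of private randomness) that maximizes $$H(\hat p_i)+\mathrm{UCD}_{\mathrm{bias}}^{(i)}\bigl(t^{-\alpha},N_i(t-1)\bigr),\qquad \mathrm{UCD}_{\mathrm{bias}}^{(i)}(\delta,n)=\log\Bigl(1+\frac{|\mathcal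 X_i|-1}{n}\Bigr)+\sqrt{\frac{2\log^2 n}{n}\log\frac2\delta},$$ where $\hat p_i$ is the empirical mass function of the $N_i(t-1)$ symbols of arm $i$ observed in rounds $1,\dots,t-1$; an arm with $N_i(t-1)=0$ is given the value $+\infty$. Then for every $\beta\in(0,1)$ and every integer $t\ge1$, $$R(t)\le\sum_{i:\Delta_i>0}\Bigl[\Gamma_{\mathrm{bias}}(\alpha,\beta,\mathcal X_i,\Delta_i,t)\,\Delta_i+\frac{2(\alpha-1)}{\alpha-2}\,\Delta_i\Bigr],$$ where, with $\Lambda_2(s)=s\log^2 s$, $$\Gamma_{\mathrm{bias}}(\alpha,\beta,\mathcal Y,\Delta,t)=\max\Bigl\{\frac{|\mathcal Y|-1}{e^{\beta\Delta/2}-1},\;15\,\Lambda_2\Bigl(\frac{8\log(2t^\alpha)}{(1-\beta)^2\Delta^2}\Bigr)\Bigr\}.$$ -/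

import Mathlib

open MeasureTheory ProbabilityTheory
open scoped BigOperators

noncomputable section

namespace IMAB

/-- The linear-times-polylogarithmic function `Λ_k(s) = s log^k s`. -/
def Lam (k : ℕ) (s : ℝ) : ℝ := s * Real.log s ^ k

/-- Shannon entropy, in nats, of a real-valued mass function on a finite alphabet
(the term of a letter of mass zero is `0`). -/
def entropy {Y : Type*} [Fintype Y] (q : Y → ℝ) : ℝ := -∑ y, q y * Real.log (q y)

/-- Entropy of a probability mass function on a finite alphabet. -/
def pmfEntropy {Y : Type*} [Fintype Y] (p : PMF Y) : ℝ := entropy fun y => (p y).toReal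

/-- Empirical mass function of a nonempty finite sequence of samples. -/
def empirical {Y : Type*} [DecidableEq Y] (s : List Y) (y : Y) : ℝ :=
  (s.count y : ℝ) / (s.length : ℝ)

/-- Plug-in entropy estimator: the entropy of the empirical mass function. -/
def plugIn {Y : Type*} [Fintype Y] [DecidableEq Y] (s : List Y) : ℝ := entropy (empirical s)

/-- Bias bound `B(n) = log (1 + (m - 1) / n)` for an alphabet of `m` letters, `n ≥ 1`. -/
def biasBound (m n : ℕ) : ℝ := Real.log (1 + ((m : ℝ) - 1) / (n : ℝ))

/-- Bias-corrected upper confidence deviation for an alphabet of `m` letters, `n ≥ 1`. -/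
def ucdBias (m : ℕ) (δ : ℝ) (n : ℕ) : ℝ :=
  biasBound m n + Real.sqrt (2 * Real.log (n : ℝ) ^ 2 / (n : ℝ) * Real.log (2 / δ))

/-- The quantity `Γ_bias` for an alphabet of `m` letters, a gap `Δ` and a round `t`. -/
def gammaBias (α β : ℝ) (m : ℕ) (Δ : ℝ) (t : ℕ) : ℝ :=
  max (((m : ℝ) - 1) / (Real.exp (β * Δ / 2) - 1))
    (15 * Lam 2 (8 * Real.log (2 * (t : ℝ) ^ α) / ((1 - β) ^ 2 * Δ ^ 2)))

section Arms

variable {K : ℕ} {A : Fin K → Type*} [∀ i, Fintype (A i)]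

/-- The largest entropy among the arms (a maximum, since there are finitely many arms). -/
def maxEntropy (p : ∀ i, PMF (A i)) : ℝ := ⨆ i, pmfEntropy (p i)

/-- The gap of arm `i`. -/
def gap (p : ∀ i, PMF (A i)) (i : Fin K) : ℝ := maxEntropy p - pmfEntropy (p i)

end Arms

section Game

variable {K : ℕ} {A : Fin K → Type*} {Ω : Type*}

/-- Number of rounds among `1, …, t` in which arm `i` is played, where `I τ` is the arm played
at round `τ`. -/
def numPlays (I : ℕ → Ω → Fin K) (i : Fin K) (t : ℕ) (ω : Ω) : ℕ :=
  ∑ τ ∈ Finset.Icc 1 t, if I τ ω = i then 1 else 0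

/-- The sequence of symbols of arm `i` observed in rounds `1, …, t`, where `X i τ` is the symbol
that source `i` emits at round `τ`; it is observed only if `I τ = i`. -/
def samples (X : ∀ i, ℕ → Ω → A i) (I : ℕ → Ω → Fin K) (i : Fin K) : ℕ → Ω → List (A i)
  | 0, _ => []
  | t + 1, ω =>
    if I (t + 1) ω = i then samples X I i t ω ++ [X i (t + 1) ω] else samples X I i t ω

/-- The bandit environment. Source `i` is memoryless with mass function `p i`: at every round it
emits a fresh symbol, independent of the past. The arm of round `t + 1` is chosen on
the basis of the past, `ℱ t`, which may also contain private randomness of the player (used, for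
instance, to break ties). -/
structure IsBanditGame [∀ i, MeasurableSpace (A i)] {mΩ : MeasurableSpace Ω} (μ : Measure Ω)
    (p : ∀ i, PMF (A i)) (ℱ : Filtration ℕ mΩ) (X : ∀ i, ℕ → Ω → A i)
    (I : ℕ → Ω → Fin K) : Prop where
  measurable_symbol : ∀ i t, Measurable[ℱ (t + 1)] (X i (t + 1))
  law_symbol : ∀ i t x, μ (X i (t + 1) ⁻¹' {x}) = p i x
  indep_symbol : ∀ i t, Indep (MeasurableSpace.comap (X i (t + 1)) inferInstance) (ℱ t) μ
  measurable_choice : ∀ t, Measurable[ℱ t] (I (t + 1))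

/-- Index of an arm with observed samples `s`: estimated entropy plus confidence deviation.
The estimator and the deviation are only meaningful for at least one sample; an arm that has not
been played yet has index `+∞`. -/
def ucbIndex {Y : Type*} (Hhat : List Y → ℝ) (UCD : List Y → ℝ → ℝ) (δ : ℝ) (s : List Y) :
    EReal :=
  match s with
  | [] => ⊤
  | y :: l => ((Hhat (y :: l) + UCD (y :: l) δ : ℝ) : EReal)

/-- The generic UCB algorithm with entropy estimators `Hhat i`, confidence deviations `UCD i` and
confidence function `δ`: at every round `t + 1` the arm played is a maximizer of the index
(ties are broken arbitrarily). -/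
def IsUCB (Hhat : ∀ i, List (A i) → ℝ) (UCD : ∀ i, List (A i) → ℝ → ℝ) (δ : ℕ → ℝ)
    (X : ∀ i, ℕ → Ω → A i) (I : ℕ → Ω → Fin K) : Prop :=
  ∀ (t : ℕ) (ω : Ω) (j : Fin K),
    ucbIndex (Hhat j) (UCD j) (δ (t + 1)) (samples X I j t ω) ≤
      ucbIndex (Hhat (I (t + 1) ω)) (UCD (I (t + 1) ω)) (δ (t + 1))
        (samples X I (I (t + 1) ω) t ω)

/-- The expected pseudo-regret `R(t) = t · max_i H_i - ∑ i, E[N_i(t)] · H_i`. -/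
def pseudoRegret [∀ i, Fintype (A i)] [MeasurableSpace Ω] (μ : Measure Ω) (p : ∀ i, PMF (A i))
    (I : ℕ → Ω → Fin K) (t : ℕ) : ℝ :=
  (t : ℝ) * maxEntropy p - ∑ i, (∫ ω, (numPlays I i t ω : ℝ) ∂μ) * pmfEntropy (p i)

end Game

end IMAB

end

/-! Since the play counts sum to `t`, the pseudo-regret is the sum over arms of expected plays times
gap, so it suffices to bound the plays of each suboptimal arm `i`. With `u = ⌊γ⌋ + 1`, where `γ` is
the `gammaBias` of the arm, the plays of `i` number at most `u` plus the rounds in which `i` is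
chosen after at least `u` observations (`numPlays_le_add_late`).

In such a late round the bias bound plus twice the deviation of arm `i` is below its gap. Being
chosen then forces one of two errors: the index of an optimal arm lies below its entropy, or the
plug-in estimate of arm `i` exceeds its entropy by more than the deviation (`deviation_of_played`).
The second error involves no bias, because the plug-in estimator underestimates entropy on average.

For a fixed sample size each error has probability at most `δ / 2`. This follows from McDiarmid's
inequality, as replacing one of `n` letters moves the plug-in entropy by at most `2 log n / n`,
together with the bias bound. `IsBanditGame.real_samples_le` transfers these tails from independent
words to adaptively collected samples. A union over the `τ` possible sample sizes, with `δ = (τ + 1)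
^ (-α)`, gives a series bounded by `1 / (α - 2)`. -/

namespace IMAB

/-! ### Expectations over independent words and McDiarmid's inequality. -/

section ListExpectation

variable {Y : Type*} [Fintype Y]

lemma pmf_sum_toReal (p : PMF Y) : ∑ y, (p y).toReal = 1 := by
  rw [← ENNReal.toReal_sum fun y _ => p.apply_ne_top y, ← tsum_fintype (L := .unconditional Y),
    p.tsum_coe, ENNReal.toReal_one]

lemma pmf_toReal_le_one (p : PMF Y) (y : Y) : (p y).toReal ≤ 1 := by
  rw [← pmf_sum_toReal p]
  exact Finset.single_le_sum (f := fun y => (p y).toReal)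
    (fun _ _ => ENNReal.toReal_nonneg) (Finset.mem_univ y)

/-- Expectation of `f` over words of `n` independent letters with law `p`. -/
noncomputable def wordExp (p : PMF Y) : ℕ → (List Y → ℝ) → ℝ
  | 0, f => f []
  | n + 1, f => ∑ x, (p x).toReal * wordExp p n fun l => f (x :: l)

lemma wordExp_mono (p : PMF Y) {n : ℕ} {f g : List Y → ℝ}
    (h : ∀ l, l.length = n → f l ≤ g l) : wordExp p n f ≤ wordExp p n g := by
  induction n generalizing f g with
  | zero => exact h [] rfl
  | succ n ih =>
    exact Finset.sum_le_sum fun x _ => mul_le_mul_of_nonneg_left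
      (ih fun l hl => h (x :: l) (by simp [hl])) ENNReal.toReal_nonneg

lemma wordExp_congr (p : PMF Y) {n : ℕ} {f g : List Y → ℝ}
    (h : ∀ l, l.length = n → f l = g l) : wordExp p n f = wordExp p n g :=
  le_antisymm (wordExp_mono p fun l hl => (h l hl).le) (wordExp_mono p fun l hl => (h l hl).ge)

lemma wordExp_const (p : PMF Y) (n : ℕ) (c : ℝ) : wordExp p n (fun _ => c) = c := by
  induction n with
  | zero => rfl
  | succ n ih => simp only [wordExp, ih]; rw [← Finset.sum_mul, pmf_sum_toReal, one_mul]

lemma wordExp_add (p : PMF Y) (n : ℕ) (f g : List Y → ℝ) :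
    wordExp p n (fun l => f l + g l) = wordExp p n f + wordExp p n g := by
  induction n generalizing f g with
  | zero => rfl
  | succ n ih => simp only [wordExp, ih]; simp [mul_add, Finset.sum_add_distrib]

lemma wordExp_const_mul (p : PMF Y) (n : ℕ) (c : ℝ) (f : List Y → ℝ) :
    wordExp p n (fun l => c * f l) = c * wordExp p n f := by
  induction n generalizing f with
  | zero => rfl
  | succ n ih =>
    simp only [wordExp, ih]; rw [Finset.mul_sum]
    exact Finset.sum_congr rfl fun x _ => by ring

lemma wordExp_sum (p : PMF Y) (n : ℕ) {ι : Type*} (s : Finset ι) (f : ι → List Y → ℝ) :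
    wordExp p n (fun l => ∑ i ∈ s, f i l) = ∑ i ∈ s, wordExp p n (f i) := by
  classical
  induction s using Finset.induction_on with
  | empty => simp [wordExp_const]
  | insert a s ha ih => simp [Finset.sum_insert ha, wordExp_add, ih]

lemma wordExp_neg (p : PMF Y) (n : ℕ) (f : List Y → ℝ) :
    wordExp p n (fun l => -f l) = -wordExp p n f := by
  simpa using wordExp_const_mul p n (-1) f

lemma hoeffding_pmf (p : PMF Y) (g : Y → ℝ) {c : ℝ} (hc : ∀ x y, g x - g y ≤ c) (s : ℝ) :
    ∑ x, (p x).toReal * Real.exp (s * g x)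
      ≤ Real.exp (s * ∑ x, (p x).toReal * g x + s ^ 2 * c ^ 2 / 8) := by
  let _ : MeasurableSpace Y := ⊤
  obtain ⟨x₀, -⟩ := p.support_nonempty
  have : Nonempty Y := ⟨x₀⟩
  obtain ⟨m, hm⟩ := Finite.exists_min g
  have hc0 : 0 ≤ c := by simpa using hc x₀ x₀
  have hmem : ∀ᵐ x ∂p.toMeasure, g x ∈ Set.Icc (g m) (g m + c) :=
    Filter.Eventually.of_forall fun x => ⟨hm x, by linarith [hc x m]⟩
  have key := (hasSubgaussianMGF_of_mem_Icc (μ := p.toMeasure) (X := g)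
    (measurable_from_top).aemeasurable hmem).mgf_le s
  rw [mgf, PMF.integral_eq_sum, PMF.integral_eq_sum] at key
  simp only [smul_eq_mul] at key
  set M := ∑ x, (p x).toReal * g x
  have h1 : ∑ x, (p x).toReal * Real.exp (s * g x)
      = Real.exp (s * M) * ∑ x, (p x).toReal * Real.exp (s * (g x - M)) := by
    rw [Finset.mul_sum]
    refine Finset.sum_congr rfl fun x _ => ?_
    rw [mul_left_comm, ← Real.exp_add]
    congr 2; ring
  rw [h1, Real.exp_add]
  refine mul_le_mul_of_nonneg_left (key.trans (Real.exp_le_exp.2 (le_of_eq ?_)))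
    (Real.exp_pos _).le
  simp [abs_of_nonneg hc0]
  ring

/-- Peel off the first letter. The conditional mean `g` given that letter again has oscillation at
most `c`, so Hoeffding's lemma costs one more `s ^ 2 * c ^ 2 / 8`, and the tail is handled by
induction. -/
lemma wordExp_exp_le (p : PMF Y) (n : ℕ) {c : ℝ} (f : List Y → ℝ)
    (hf : ∀ l x y r, l.length + r.length + 1 = n → f (l ++ x :: r) - f (l ++ y :: r) ≤ c)
    (s : ℝ) :
    wordExp p n (fun l => Real.exp (s * f l))
      ≤ Real.exp (s * wordExp p n f + n * (s ^ 2 * c ^ 2 / 8)) := by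
  induction n generalizing f with
  | zero => simp [wordExp]
  | succ n ih =>
    set g : Y → ℝ := fun x => wordExp p n fun l => f (x :: l)
    have hg : ∀ x y, g x - g y ≤ c := by
      intro x y
      have : g x ≤ wordExp p n fun l => f (y :: l) + c := wordExp_mono p fun l hl => by
        have := hf [] x y l (by simp [hl])
        simp only [List.nil_append] at this
        linarith
      rw [wordExp_add, wordExp_const] at this
      simp only [g] at this ⊢
      linarith
    calc wordExp p (n + 1) (fun l => Real.exp (s * f l))
        ≤ ∑ x, (p x).toReal * (Real.exp (s * g x) * Real.exp (n * (s ^ 2 * c ^ 2 / 8))) := by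
          refine Finset.sum_le_sum fun x _ => mul_le_mul_of_nonneg_left ?_ ENNReal.toReal_nonneg
          rw [← Real.exp_add]
          exact ih (fun l => f (x :: l)) fun l y z r h => hf (x :: l) y z r (by simp; omega)
      _ = (∑ x, (p x).toReal * Real.exp (s * g x)) * Real.exp (n * (s ^ 2 * c ^ 2 / 8)) := by
          rw [Finset.sum_mul]
          exact Finset.sum_congr rfl fun x _ => by ring
      _ ≤ Real.exp (s * ∑ x, (p x).toReal * g x + s ^ 2 * c ^ 2 / 8)
            * Real.exp (n * (s ^ 2 * c ^ 2 / 8)) :=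
          mul_le_mul_of_nonneg_right (hoeffding_pmf p g hg s) (Real.exp_pos _).le
      _ = _ := by
          rw [← Real.exp_add]
          congr 1
          simp only [wordExp, g]
          push_cast
          ring

open Classical in
/-- **McDiarmid's inequality** for a function of `n` independent letters. -/
lemma mcdiarmid (p : PMF Y) {n : ℕ} (hn : 0 < n) {c : ℝ} (hc : 0 < c) (f : List Y → ℝ)
    (hf : ∀ l x y r, l.length + r.length + 1 = n → f (l ++ x :: r) - f (l ++ y :: r) ≤ c)
    {ε : ℝ} (hε : 0 ≤ ε) :
    wordExp p n (fun l => if wordExp p n f + ε ≤ f l then 1 else 0)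
      ≤ Real.exp (-(2 * ε ^ 2 / (n * c ^ 2))) := by
  have hn' : (0 : ℝ) < n := by exact_mod_cast hn
  set m := wordExp p n f
  -- The minimizer of the Chernoff exponent `-s ε + n s² c² / 8`.
  set s : ℝ := 4 * ε / (n * c ^ 2)
  have hs : 0 ≤ s := by positivity
  calc wordExp p n (fun l => if m + ε ≤ f l then 1 else 0)
      ≤ wordExp p n (fun l => Real.exp (-(s * (m + ε))) * Real.exp (s * f l)) := by
        refine wordExp_mono p fun l _ => ?_
        rw [← Real.exp_add]
        split_ifs with h
        · apply Real.one_le_exp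
          nlinarith [mul_le_mul_of_nonneg_left h hs]
        · exact (Real.exp_pos _).le
    _ ≤ Real.exp (-(s * (m + ε))) * Real.exp (s * m + n * (s ^ 2 * c ^ 2 / 8)) := by
        rw [wordExp_const_mul]
        exact mul_le_mul_of_nonneg_left (wordExp_exp_le p n f hf s) (Real.exp_pos _).le
    _ = _ := by
        rw [← Real.exp_add]
        congr 1
        simp only [s]
        field_simp
        ring

end ListExpectation

/-! ### First two moments of letter counts. -/

section Counts

variable {Y : Type*} [Fintype Y] [DecidableEq Y]

lemma wordExp_count (p : PMF Y) (n : ℕ) (y : Y) :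
    wordExp p n (fun l => (l.count y : ℝ)) = n * (p y).toReal := by
  induction n with
  | zero => simp [wordExp]
  | succ n ih =>
    have h : ∀ x, wordExp p n (fun l => ((x :: l).count y : ℝ))
        = n * (p y).toReal + if x = y then 1 else 0 := by
      intro x
      rw [← ih, ← wordExp_const p n (if x = y then 1 else 0), ← wordExp_add]
      refine wordExp_congr p fun l _ => ?_
      simp [List.count_cons]
    simp only [wordExp, h, mul_add, Finset.sum_add_distrib, ← Finset.sum_mul, pmf_sum_toReal]
    simp
    ring

lemma wordExp_count_sq (p : PMF Y) (n : ℕ) (y : Y) :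
    wordExp p n (fun l => (l.count y : ℝ) ^ 2)
      = n * (p y).toReal * (1 - (p y).toReal) + (n * (p y).toReal) ^ 2 := by
  induction n with
  | zero => simp [wordExp]
  | succ n ih =>
    have h : ∀ x, wordExp p n (fun l => ((x :: l).count y : ℝ) ^ 2)
        = (n * (p y).toReal * (1 - (p y).toReal) + (n * (p y).toReal) ^ 2)
          + if x = y then 2 * (n * (p y).toReal) + 1 else 0 := by
      intro x
      by_cases hx : x = y
      · rw [if_pos hx, ← ih, ← wordExp_count, ← wordExp_const_mul]
        conv_rhs => rw [← wordExp_const p n 1, ← wordExp_add, ← wordExp_add]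
        refine wordExp_congr p fun l _ => ?_
        simp [hx]
        ring
      · rw [if_neg hx, ← ih, add_zero]
        refine wordExp_congr p fun l _ => ?_
        simp [hx]
    simp only [wordExp, h, mul_add, Finset.sum_add_distrib, ← Finset.sum_mul, pmf_sum_toReal]
    simp
    ring

end Counts

/-! ### Bias of the plug-in estimator. -/

lemma empirical_nonneg {Y : Type*} [DecidableEq Y] (l : List Y) (y : Y) : 0 ≤ empirical l y := by
  unfold empirical; positivity

lemma empirical_le_one {Y : Type*} [DecidableEq Y] (l : List Y) (y : Y) : empirical l y ≤ 1 :=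
  div_le_one_of_le₀ (by exact_mod_cast List.count_le_length) (Nat.cast_nonneg _)

lemma one_le_card_of_pmf {Y : Type*} [Fintype Y] (p : PMF Y) : 1 ≤ Fintype.card Y := by
  obtain ⟨x, -⟩ := p.support_nonempty
  exact Fintype.card_pos_iff.2 ⟨x⟩

section PlugIn

variable {Y : Type*} [Fintype Y] [DecidableEq Y]

lemma wordExp_empirical (p : PMF Y) {n : ℕ} (hn : 0 < n) (y : Y) :
    wordExp p n (fun l => empirical l y) = (p y).toReal := by
  have hn' : (0 : ℝ) < n := by exact_mod_cast hn
  rw [wordExp_congr p (g := fun l => (n : ℝ)⁻¹ * (l.count y : ℝ)) fun l hl => by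
    rw [empirical, hl, div_eq_inv_mul], wordExp_const_mul, wordExp_count]
  field_simp

lemma wordExp_empirical_sq (p : PMF Y) {n : ℕ} (hn : 0 < n) (y : Y) :
    wordExp p n (fun l => empirical l y ^ 2)
      = (p y).toReal * (1 - (p y).toReal) / n + (p y).toReal ^ 2 := by
  have hn' : (0 : ℝ) < n := by exact_mod_cast hn
  rw [wordExp_congr p (g := fun l => ((n : ℝ) ^ 2)⁻¹ * (l.count y : ℝ) ^ 2) fun l hl => by
    rw [empirical, hl, div_pow, div_eq_inv_mul], wordExp_const_mul, wordExp_count_sq]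
  field_simp

lemma wordExp_plugIn (p : PMF Y) (n : ℕ) :
    wordExp p n plugIn
      = -∑ y, wordExp p n fun l => empirical l y * Real.log (empirical l y) := by
  change wordExp p n (fun l => -∑ y, empirical l y * Real.log (empirical l y)) = _
  rw [wordExp_neg, wordExp_sum]

lemma mul_log_tangent {q x : ℝ} (hq : 0 < q) (hx : 0 ≤ x) :
    (Real.log q + 1) * x - q ≤ x * Real.log x := by
  rcases hx.eq_or_lt with rfl | hx
  · simp [hq.le]
  · have h := Real.log_le_sub_one_of_pos (div_pos hq hx)
    rw [Real.log_div hq.ne' hx.ne'] at h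
    have h2 := mul_le_mul_of_nonneg_left h hx.le
    have h3 : x * (q / x - 1) = q - x := by field_simp
    rw [h3] at h2
    linarith

/-- This is `log z ≤ z - 1` at `z = x / (q a)`. A quadratic majorant is wanted because the second
moment of the empirical mass is explicit; `a` is left free for tuning. -/
lemma mul_log_le_quadratic {a q x : ℝ} (ha : 0 < a) (hq : 0 < q) (hx : 0 ≤ x) :
    x * Real.log x ≤ (Real.log q + Real.log a - 1) * x + (q * a)⁻¹ * x ^ 2 := by
  rcases hx.eq_or_lt with rfl | hx
  · simp
  · have h := Real.log_le_sub_one_of_pos (div_pos hx (mul_pos hq ha))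
    rw [Real.log_div hx.ne' (mul_pos hq ha).ne', Real.log_mul hq.ne' ha.ne'] at h
    have h2 := mul_le_mul_of_nonneg_left h hx.le
    have h3 : x * (x / (q * a) - 1) = (q * a)⁻¹ * x ^ 2 - x := by
      rw [div_eq_mul_inv]; ring
    rw [h3] at h2
    linarith

/-- The plug-in estimator underestimates the entropy on average. -/
lemma wordExp_plugIn_le (p : PMF Y) {n : ℕ} (hn : 0 < n) :
    wordExp p n plugIn ≤ pmfEntropy p := by
  rw [wordExp_plugIn, pmfEntropy, entropy, neg_le_neg_iff]
  refine Finset.sum_le_sum fun y _ => ?_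
  -- Jensen by tangent lines: `q` is the point of tangency, taken to be `p y`, or sent to `0` when
  -- `p y = 0`.
  have key : ∀ q : ℝ, 0 < q → (Real.log q + 1) * (p y).toReal - q
      ≤ wordExp p n fun l => empirical l y * Real.log (empirical l y) := by
    intro q hq
    have h := wordExp_mono p (n := n)
      (f := fun l => (Real.log q + 1) * empirical l y + -q)
      (g := fun l => empirical l y * Real.log (empirical l y)) fun l _ => by
        simpa [sub_eq_add_neg] using mul_log_tangent hq (empirical_nonneg l y)
    rwa [wordExp_add, wordExp_const_mul, wordExp_const, wordExp_empirical p hn,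
      ← sub_eq_add_neg] at h
  rcases (ENNReal.toReal_nonneg (a := p y)).eq_or_lt with h0 | h0
  · rw [← h0, zero_mul]
    refine le_of_forall_pos_le_add fun q hq => ?_
    have := key q hq
    rw [← h0] at this
    linarith
  · have := key _ h0
    linarith

/-- The bias of the plug-in estimator is at most `biasBound`. -/
lemma pmfEntropy_le_wordExp_plugIn (p : PMF Y) {n : ℕ} (hn : 0 < n) :
    pmfEntropy p ≤ wordExp p n plugIn + biasBound (Fintype.card Y) n := by
  have hn' : (0 : ℝ) < n := by exact_mod_cast hn
  have hm : (1 : ℝ) ≤ Fintype.card Y := by exact_mod_cast one_le_card_of_pmf p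
  -- With this `a` the second-moment terms sum to exactly one (`hone`) and cancel the `-1`; what
  -- remains is `log a`, the bias bound.
  set a : ℝ := 1 + ((Fintype.card Y : ℝ) - 1) / n with ha_def
  have ha : 0 < a := by
    have : 0 ≤ ((Fintype.card Y : ℝ) - 1) / n := div_nonneg (by linarith) hn'.le
    linarith
  have key : ∀ y, (wordExp p n fun l => empirical l y * Real.log (empirical l y))
      ≤ (p y).toReal * Real.log (p y).toReal + (Real.log a - 1) * (p y).toReal
        + a⁻¹ * ((1 - (p y).toReal) / n + (p y).toReal) := by
    intro y
    have h1 := pmf_toReal_le_one p y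
    rcases (ENNReal.toReal_nonneg (a := p y)).eq_or_lt with h0 | h0
    · rw [← h0]
      refine (wordExp_mono p (g := fun _ => 0) fun l _ => ?_).trans ?_
      · exact mul_nonpos_of_nonneg_of_nonpos (empirical_nonneg l y)
          (Real.log_nonpos (empirical_nonneg l y) (empirical_le_one l y))
      · rw [wordExp_const]
        simp only [zero_mul, mul_zero, sub_zero, add_zero, zero_add]
        positivity
    · refine (wordExp_mono p fun l _ =>
        mul_log_le_quadratic ha h0 (empirical_nonneg l y)).trans (le_of_eq ?_)
      rw [wordExp_add, wordExp_const_mul, wordExp_const_mul, wordExp_empirical p hn,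
        wordExp_empirical_sq p hn]
      field_simp
      ring
  have hsum := Finset.sum_le_sum fun y (_ : y ∈ Finset.univ) => key y
  simp only [Finset.sum_add_distrib, ← Finset.mul_sum, ← Finset.sum_div,
    Finset.sum_sub_distrib, pmf_sum_toReal] at hsum
  simp only [Finset.sum_const, Finset.card_univ, nsmul_eq_mul, mul_one] at hsum
  have hone : a⁻¹ * (((Fintype.card Y : ℝ) - 1) / n + 1) = 1 := by
    rw [add_comm, ← ha_def, inv_mul_cancel₀ ha.ne']
  rw [wordExp_plugIn, pmfEntropy, entropy, biasBound, ← ha_def]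
  linarith

/-! ### Bounded differences of the plug-in estimator. -/

lemma succ_mul_log_succ_bounds (k : ℕ) :
    0 ≤ ((k : ℝ) + 1) * Real.log (k + 1) - k * Real.log k ∧
      ((k : ℝ) + 1) * Real.log (k + 1) - k * Real.log k ≤ 2 * Real.log (k + 1) := by
  rcases Nat.eq_zero_or_pos k with rfl | hk
  · simp
  have hk' : (1 : ℝ) ≤ k := by exact_mod_cast hk
  have hk0 : (0 : ℝ) < k := by linarith
  have hl := Real.log_nonneg hk'
  have hmono : Real.log k ≤ Real.log (k + 1) := Real.log_le_log hk0 (by linarith)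
  constructor
  · nlinarith
  · have h1 := Real.log_le_sub_one_of_pos (show (0 : ℝ) < ((k : ℝ) + 1) / k by positivity)
    rw [Real.log_div (by positivity) hk0.ne'] at h1
    have h2 := Real.one_sub_inv_le_log_of_pos hk0
    have h3 : ((k : ℝ) + 1) / k - 1 = (k : ℝ)⁻¹ := by field_simp; ring
    rw [h3] at h1
    -- The upper bound amounts to `(k - 1) (log (k + 1) - log k) ≤ log k`, and both sides are
    -- separated by `1 - 1 / k`.
    have h4 := mul_le_mul_of_nonneg_left h1 (show (0 : ℝ) ≤ k - 1 by linarith)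
    have h5 : ((k : ℝ) - 1) * (k : ℝ)⁻¹ = 1 - (k : ℝ)⁻¹ := by field_simp
    nlinarith

lemma mul_log_increment_bounds {k n : ℕ} (hk : k < n) :
    |((k : ℝ) + 1) / n * Real.log (((k : ℝ) + 1) / n) - (k : ℝ) / n * Real.log ((k : ℝ) / n)|
      ≤ Real.log n / n := by
  have hn : (0 : ℝ) < n := by exact_mod_cast (Nat.zero_le k).trans_lt hk
  have hk1 : (0 : ℝ) < (k : ℝ) + 1 := by positivity
  have hkn : (k : ℝ) + 1 ≤ n := by exact_mod_cast hk
  have e : ((k : ℝ) + 1) / n * Real.log (((k : ℝ) + 1) / n) - (k : ℝ) / n * Real.log ((k : ℝ) / n)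
      = ((((k : ℝ) + 1) * Real.log (k + 1) - k * Real.log k) - Real.log n) / n := by
    rw [Real.log_div hk1.ne' hn.ne']
    rcases Nat.eq_zero_or_pos k with rfl | hk0
    · simp; ring
    · have hk0' : (k : ℝ) ≠ 0 := by exact_mod_cast hk0.ne'
      rw [Real.log_div hk0' hn.ne']
      field_simp
      ring
  obtain ⟨h1, h2⟩ := succ_mul_log_succ_bounds k
  have h3 := Real.log_le_log hk1 hkn
  rw [e, abs_div, abs_of_pos hn]
  refine div_le_div_of_nonneg_right (abs_le.2 ⟨?_, ?_⟩) hn.le <;> linarith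

/-- The sum does not involve `x`, so when one letter is replaced only two increments of `z log z`
along the grid `k / n` remain to be compared. The counts are those of the other `n - 1` letters,
still divided by `n`. -/
lemma plugIn_insert (l r : List Y) (x : Y) {n : ℕ} (hn : l.length + r.length + 1 = n) :
    plugIn (l ++ x :: r)
      = -(∑ z, ((l ++ r).count z : ℝ) / n * Real.log (((l ++ r).count z : ℝ) / n))
        - ((((l ++ r).count x : ℝ) + 1) / n * Real.log ((((l ++ r).count x : ℝ) + 1) / n)
          - ((l ++ r).count x : ℝ) / n * Real.log (((l ++ r).count x : ℝ) / n)) := by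
  have hlen : ((l ++ x :: r).length : ℝ) = n := by
    rw [← hn]; simp; ring
  have hterm : ∀ z, empirical (l ++ x :: r) z * Real.log (empirical (l ++ x :: r) z)
      = ((l ++ r).count z : ℝ) / n * Real.log (((l ++ r).count z : ℝ) / n)
        + if x = z then (((l ++ r).count x : ℝ) + 1) / n
            * Real.log ((((l ++ r).count x : ℝ) + 1) / n)
          - ((l ++ r).count x : ℝ) / n * Real.log (((l ++ r).count x : ℝ) / n) else 0 := by
    intro z
    have hc : (l ++ x :: r).count z = (l ++ r).count z + if x = z then 1 else 0 := by
      simp [List.count_append, List.count_cons, add_assoc]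
    unfold empirical
    rw [hlen, hc]
    by_cases hz : x = z
    · subst hz; simp
    · simp [hz]
  rw [plugIn, entropy, Finset.sum_congr rfl fun z _ => hterm z, Finset.sum_add_distrib,
    Finset.sum_ite_eq, if_pos (Finset.mem_univ x)]
  ring

/-- Bounded differences of the plug-in estimator. -/
lemma plugIn_bounded_differences (l r : List Y) (x y : Y) {n : ℕ}
    (hn : l.length + r.length + 1 = n) :
    plugIn (l ++ x :: r) - plugIn (l ++ y :: r) ≤ 2 * Real.log n / n := by
  have hlt : ∀ z, (l ++ r).count z < n := fun z =>
    List.count_le_length.trans_lt (by rw [List.length_append]; omega)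
  have hx := (abs_le.1 (mul_log_increment_bounds (hlt x))).1
  have hy := (abs_le.1 (mul_log_increment_bounds (hlt y))).2
  rw [plugIn_insert l r x hn, plugIn_insert l r y hn]
  have : 2 * Real.log n / n = Real.log n / n + Real.log n / n := by ring
  linarith

/-! ### Tail bounds for the plug-in estimator. -/

lemma plugIn_singleton (x : Y) : plugIn [x] = 0 := by
  have := plugIn_insert [] [] x (n := 1) rfl
  simpa using this

lemma wordExp_plugIn_one (p : PMF Y) : wordExp p 1 plugIn = 0 := by
  simp [wordExp, plugIn_singleton]

/-- The deviation term of the confidence bound. -/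
noncomputable def devBound (δ : ℝ) (n : ℕ) : ℝ :=
  Real.sqrt (2 * Real.log (n : ℝ) ^ 2 / (n : ℝ) * Real.log (2 / δ))

lemma mcdiarmid_exponent {n : ℕ} (hn : 2 ≤ n) {δ : ℝ} (hδ0 : 0 < δ) (hδ1 : δ ≤ 1) :
    Real.exp (-(2 * devBound δ n ^ 2 / (n * (2 * Real.log n / n) ^ 2))) = δ / 2 := by
  have hn' : (0 : ℝ) < n := by exact_mod_cast (by omega : 0 < n)
  have hlog : 0 < Real.log n := Real.log_pos (by exact_mod_cast hn)
  have hlogδ : 0 ≤ Real.log (2 / δ) := Real.log_nonneg (by rw [le_div_iff₀ hδ0]; linarith)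
  rw [devBound, Real.sq_sqrt (by positivity)]
  have : -(2 * (2 * Real.log (n : ℝ) ^ 2 / n * Real.log (2 / δ))
      / (n * (2 * Real.log n / n) ^ 2)) = -Real.log (2 / δ) := by
    field_simp
  rw [this, ← Real.log_inv, Real.exp_log (by positivity), inv_div]

open Classical in
lemma wordExp_upper_tail (p : PMF Y) {n : ℕ} (hn : 0 < n) {δ : ℝ} (hδ0 : 0 < δ) (hδ1 : δ ≤ 1) :
    wordExp p n (fun l => if pmfEntropy p + devBound δ n < plugIn l then 1 else 0) ≤ δ / 2 := by
  have hE := wordExp_plugIn_le p hn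
  have hdev : 0 ≤ devBound δ n := Real.sqrt_nonneg _
  -- For `n = 1` the difference constant `2 log n / n` vanishes and McDiarmid does not apply, but
  -- the estimate is then always `0` and the event is empty.
  rcases (show n = 1 ∨ 2 ≤ n by omega) with rfl | hn2
  · rw [wordExp_plugIn_one] at hE
    rw [wordExp_congr p (g := fun _ => 0) fun l hl => ?_, wordExp_const]
    · positivity
    · obtain ⟨x, rfl⟩ := List.length_eq_one_iff.1 hl
      rw [if_neg]
      rw [plugIn_singleton]
      linarith
  · have hn' : (0 : ℝ) < n := by exact_mod_cast hn
    have hlog : 0 < Real.log n := Real.log_pos (by exact_mod_cast hn2)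
    rw [← mcdiarmid_exponent hn2 hδ0 hδ1]
    refine (wordExp_mono p fun l _ => ?_).trans (mcdiarmid p hn
      (c := 2 * Real.log n / n) (by positivity) plugIn
      (fun l x y r h => plugIn_bounded_differences l r x y h) hdev)
    by_cases h : pmfEntropy p + devBound δ n < plugIn l
    · rw [if_pos h, if_pos (by linarith)]
    · rw [if_neg h]; split_ifs <;> simp

open Classical in
lemma wordExp_lower_tail (p : PMF Y) {n : ℕ} (hn : 0 < n) {δ : ℝ} (hδ0 : 0 < δ) (hδ1 : δ ≤ 1) :
    wordExp p n (fun l => if plugIn l + ucdBias (Fintype.card Y) δ n < pmfEntropy p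
      then 1 else 0) ≤ δ / 2 := by
  have hE := pmfEntropy_le_wordExp_plugIn p hn
  have hdev : 0 ≤ devBound δ n := Real.sqrt_nonneg _
  have hucd : ucdBias (Fintype.card Y) δ n = biasBound (Fintype.card Y) n + devBound δ n := rfl
  rw [hucd]
  rcases (show n = 1 ∨ 2 ≤ n by omega) with rfl | hn2
  · rw [wordExp_plugIn_one] at hE
    rw [wordExp_congr p (g := fun _ => 0) fun l hl => ?_, wordExp_const]
    · positivity
    · obtain ⟨x, rfl⟩ := List.length_eq_one_iff.1 hl
      rw [if_neg]
      rw [plugIn_singleton]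
      linarith
  · have hn' : (0 : ℝ) < n := by exact_mod_cast hn
    have hlog : 0 < Real.log n := Real.log_pos (by exact_mod_cast hn2)
    rw [← mcdiarmid_exponent hn2 hδ0 hδ1]
    refine (wordExp_mono p fun l _ => ?_).trans (mcdiarmid p hn
      (c := 2 * Real.log n / n) (by positivity) (fun l => -plugIn l)
      (fun l x y r h => by linarith [plugIn_bounded_differences l r y x h]) hdev)
    rw [wordExp_neg]
    by_cases h : plugIn l + (biasBound (Fintype.card Y) n + devBound δ n) < pmfEntropy p
    · rw [if_pos h, if_pos (by linarith)]
    · rw [if_neg h]; split_ifs <;> simp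

end PlugIn

/-! ### Real inequalities behind `gammaBias` and the constant term. -/

section Numerics

lemma log_le_div_exp_one {x : ℝ} (hx : 0 < x) : Real.log x ≤ x / Real.exp 1 := by
  have h := Real.log_le_sub_one_of_pos (div_pos hx (Real.exp_pos 1))
  rw [Real.log_div hx.ne' (Real.exp_pos 1).ne', Real.log_exp] at h
  linarith

/-- If it failed, `x = log y` would satisfy `√15 log s < x` and `x < log s + 2 log x`, where `log x
≤ x / e`. This is contradictory because `1 / √15 + 2 / e < 1`, which explains the constant 15. -/
lemma mul_log_sq_le_of_Lam_le {s y : ℝ} (hy : 1 ≤ y) (h : 15 * Lam 2 s ≤ y) :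
    s * Real.log y ^ 2 ≤ y := by
  by_contra! hcon
  have hy0 : 0 < y := by linarith
  set x := Real.log y with hx_def
  have hx0 : 0 ≤ x := Real.log_nonneg hy
  have hxne : x ≠ 0 := fun h0 => by rw [h0] at hcon; norm_num at hcon; linarith
  have hx : 0 < x := lt_of_le_of_ne hx0 hxne.symm
  have he := Real.exp_one_gt_d9
  -- For `s ≤ 1` the claim already follows from `log² y ≤ y`.
  have hs : 1 < s := by
    by_contra! hs
    have h1 := Real.add_one_le_exp (x / 2 - 1)
    have h2 : Real.exp (x / 2 - 1) ^ 2 * Real.exp 1 ^ 2 = y := by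
      rw [← mul_pow, ← Real.exp_add, ← Real.exp_nat_mul, ← Real.exp_log hy0, ← hx_def]
      congr 1; push_cast; ring
    have h3 : x / 2 * 2 ≤ Real.exp (x / 2 - 1) * Real.exp 1 :=
      mul_le_mul (by linarith) (by linarith) (by norm_num) (Real.exp_pos _).le
    rw [← mul_pow] at h2
    nlinarith [sq_nonneg x]
  have hs0 : 0 < s := by linarith
  have hL : 0 < Real.log s := Real.log_pos hs
  rw [Lam] at h
  have h1 : 15 * Real.log s ^ 2 < x ^ 2 := by
    have : s * (15 * Real.log s ^ 2) < s * x ^ 2 := by linarith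
    exact lt_of_mul_lt_mul_left this hs0.le
  have h2 : 3.87 * Real.log s < x := by
    refine lt_of_pow_lt_pow_left₀ 2 hx0 ?_
    nlinarith [sq_nonneg (Real.log s)]
  have h3 : x < Real.log s + 2 * Real.log x := by
    have := Real.log_lt_log hy0 hcon
    rwa [Real.log_mul hs0.ne' (by positivity), Real.log_pow, ← hx_def] at this
  have h4 := log_le_div_exp_one hx
  have h5 : x / Real.exp 1 ≤ x / 2.718 := div_le_div_of_nonneg_left hx0 (by norm_num) (by linarith)
  have h6 : x / 2.718 ≤ 0.368 * x := by rw [div_le_iff₀ (by norm_num)]; linarith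
  linarith

/-- Telescoping form of comparison with the integral of `x ^ (1 - α)`; a Bernoulli-type inequality
for `(t / u) ^ (2 - α)` controls each step. -/
lemma sum_mul_rpow_neg_le {α : ℝ} (hα : 2 < α) {t : ℕ} (ht : 1 ≤ t) :
    ∑ τ ∈ Finset.Icc 1 t, ((τ : ℝ) - 1) * (τ : ℝ) ^ (-α)
      ≤ (1 - (t : ℝ) ^ (2 - α)) / (α - 2) := by
  have hb : 0 < α - 2 := by linarith
  induction t, ht using Nat.le_induction with
  | base => simp
  | succ t ht ih =>
    rw [Finset.sum_Icc_succ_top (by omega)]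
    have ht0 : (0 : ℝ) < t := by exact_mod_cast ht
    have ht1 : (0 : ℝ) < (t : ℝ) + 1 := by linarith
    push_cast
    set u : ℝ := (t : ℝ) + 1 with hu
    have h1 : (α - 2) * (1 - t / u) + 1 ≤ (t / u) ^ (2 - α) := by
      rw [Real.rpow_def_of_pos (by positivity)]
      refine le_trans ?_ (Real.add_one_le_exp _)
      have := Real.log_le_sub_one_of_pos (show 0 < (t : ℝ) / u by positivity)
      nlinarith
    have h2 : (t : ℝ) ^ (2 - α) = (t / u) ^ (2 - α) * u ^ (2 - α) := by
      rw [← Real.mul_rpow (by positivity) ht1.le]; congr 1; field_simp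
    have h3 : u ^ (2 - α) = u ^ 2 * u ^ (-α) := by
      rw [sub_eq_add_neg, Real.rpow_add ht1, Real.rpow_two]
    have hup : 0 < u ^ (2 - α) := Real.rpow_pos_of_pos ht1 _
    have h4 : (α - 2) * ((u - 1) * u ^ (-α)) ≤ (t : ℝ) ^ (2 - α) - u ^ (2 - α) := by
      have h5 := mul_le_mul_of_nonneg_right h1 hup.le
      rw [← h2] at h5
      have h6 : (α - 2) * (1 - t / u) * u ^ (2 - α) = (α - 2) * u * u ^ (-α) := by
        rw [h3]
        have : (1 - (t : ℝ) / u) = 1 / u := by field_simp; rw [hu]; ring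
        rw [this]; field_simp
      have h7 : 0 < u ^ (-α) := Real.rpow_pos_of_pos ht1 _
      nlinarith [mul_pos hb h7]
    have h8 : (u - 1) * u ^ (-α) ≤ ((t : ℝ) ^ (2 - α) - u ^ (2 - α)) / (α - 2) := by
      rw [le_div_iff₀ hb]; linarith
    calc _ ≤ (1 - (t : ℝ) ^ (2 - α)) / (α - 2)
          + ((t : ℝ) ^ (2 - α) - u ^ (2 - α)) / (α - 2) := add_le_add ih h8
      _ = _ := by ring

/-- Beyond `gammaBias` observations twice the confidence deviation is below the gap. -/
lemma ucdBias_add_devBound_lt {α β Δ : ℝ} (hβ0 : 0 < β) (hβ1 : β < 1) (hΔ : 0 < Δ)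
    (hα : 0 < α) {m n τ t : ℕ} (hm : 1 ≤ m) (hn : 1 ≤ n) (hτ : 1 ≤ τ) (hτt : τ ≤ t)
    (h : gammaBias α β m Δ t ≤ n) :
    ucdBias m ((τ : ℝ) ^ (-α)) n + devBound ((τ : ℝ) ^ (-α)) n < Δ := by
  have hn' : (0 : ℝ) < n := by exact_mod_cast hn
  have hτ' : (0 : ℝ) < τ := by exact_mod_cast hτ
  have hm' : (1 : ℝ) ≤ m := by exact_mod_cast hm
  obtain ⟨h1, h2⟩ := max_le_iff.1 h
  have hexp : 0 < Real.exp (β * Δ / 2) - 1 := by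
    have := Real.add_one_le_exp (β * Δ / 2)
    have : 0 < β * Δ / 2 := by positivity
    linarith
  have hbias : biasBound m n ≤ β * Δ / 2 := by
    rw [div_le_iff₀ hexp] at h1
    have h3 : ((m : ℝ) - 1) / n ≤ Real.exp (β * Δ / 2) - 1 := by
      rw [div_le_iff₀ hn']; linarith
    have h4 : 0 ≤ ((m : ℝ) - 1) / n := div_nonneg (by linarith) hn'.le
    rw [biasBound, Real.log_le_iff_le_exp (by linarith)]
    linarith
  have hs := mul_log_sq_le_of_Lam_le (by exact_mod_cast hn) h2
  have hdev : devBound ((τ : ℝ) ^ (-α)) n ≤ (1 - β) * Δ / 2 := by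
    have hb : 0 < 1 - β := by linarith
    refine Real.sqrt_le_iff.2 ⟨by positivity, ?_⟩
    -- The confidence level belongs to round `τ`, whereas `gammaBias` is evaluated at the horizon `t
    -- ≥ τ`.
    have hle : Real.log (2 / (τ : ℝ) ^ (-α)) ≤ Real.log (2 * (t : ℝ) ^ α) := by
      rw [Real.rpow_neg hτ'.le, div_inv_eq_mul]
      refine Real.log_le_log (by positivity) ?_
      gcongr
    rw [div_mul_eq_mul_div, div_le_iff₀ (by positivity)] at hs
    rw [div_mul_eq_mul_div, div_le_iff₀ hn']
    have := mul_le_mul_of_nonneg_left hle (sq_nonneg (Real.log n))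
    nlinarith
  have : ucdBias m ((τ : ℝ) ^ (-α)) n
      = biasBound m n + devBound ((τ : ℝ) ^ (-α)) n := rfl
  -- The bias enters once and the deviation twice, so the total is at most `Δ - β Δ / 2`, strictly
  -- below the gap; strictness handles ties.
  have : 0 < β * Δ := by positivity
  linarith

lemma gammaBias_nonneg {α β Δ : ℝ} (hβ0 : 0 < β) (hΔ : 0 < Δ) {m : ℕ} (hm : 1 ≤ m) (t : ℕ) :
    0 ≤ gammaBias α β m Δ t := by
  have hm' : (1 : ℝ) ≤ m := by exact_mod_cast hm
  refine le_max_of_le_left (div_nonneg (by linarith) ?_)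
  have := Real.add_one_le_exp (β * Δ / 2)
  have : 0 < β * Δ / 2 := by positivity
  linarith

end Numerics

/-! ### Pathwise counting of plays. -/

section Counting

variable {K : ℕ} {A : Fin K → Type*} {Ω : Type*}

lemma numPlays_succ (I : ℕ → Ω → Fin K) (i : Fin K) (t : ℕ) (ω : Ω) :
    numPlays I i (t + 1) ω = numPlays I i t ω + if I (t + 1) ω = i then 1 else 0 :=
  Finset.sum_Icc_succ_top (by omega) _

lemma length_samples (X : ∀ i, ℕ → Ω → A i) (I : ℕ → Ω → Fin K) (i : Fin K) (t : ℕ) (ω : Ω) :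
    (samples X I i t ω).length = numPlays I i t ω := by
  induction t with
  | zero => simp [samples, numPlays]
  | succ t ih =>
    rw [numPlays_succ, samples]
    split_ifs <;> simp [ih]

lemma numPlays_le (I : ℕ → Ω → Fin K) (i : Fin K) (t : ℕ) (ω : Ω) : numPlays I i t ω ≤ t := by
  induction t with
  | zero => simp [numPlays]
  | succ t ih => rw [numPlays_succ]; split_ifs <;> omega

lemma numPlays_le_add_late (I : ℕ → Ω → Fin K) (i : Fin K) (u t : ℕ) (ω : Ω) :
    numPlays I i t ω
      ≤ u + ∑ τ ∈ Finset.range t, if I (τ + 1) ω = i ∧ u ≤ numPlays I i τ ω then 1 else 0 := by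
  induction t with
  | zero => simp [numPlays]
  | succ t ih =>
    rw [numPlays_succ, Finset.sum_range_succ]
    by_cases h1 : I (t + 1) ω = i
    · by_cases h2 : u ≤ numPlays I i t ω
      · simp only [h1, h2, and_self, if_true]; omega
      · simp only [h1, if_true]; omega
    · simp only [h1, false_and, if_false]; omega

end Counting

/-! ### Adaptively collected samples compared with independent words. -/

section AdaptiveSampling

variable {K : ℕ} {A : Fin K → Type*} [∀ i, Fintype (A i)] [∀ i, MeasurableSpace (A i)]
  [∀ i, MeasurableSingletonClass (A i)] {Ω : Type*} {mΩ : MeasurableSpace Ω} {μ : Measure Ω}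
  [IsProbabilityMeasure μ] {p : ∀ i, PMF (A i)} {ℱ : Filtration ℕ mΩ}
  {X : ∀ i, ℕ → Ω → A i} {I : ℕ → Ω → Fin K}

omit [∀ i, Fintype (A i)] [∀ i, MeasurableSingletonClass (A i)] [IsProbabilityMeasure μ] in
lemma IsBanditGame.measurableSet_choice (hgame : IsBanditGame μ p ℱ X I) (i : Fin K) (t : ℕ) :
    MeasurableSet[ℱ t] {ω | I (t + 1) ω = i} :=
  hgame.measurable_choice t (measurableSet_singleton i)

omit [IsProbabilityMeasure μ] in
lemma IsBanditGame.measurableSet_samples (hgame : IsBanditGame μ p ℱ X I) (i : Fin K) (t : ℕ)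
    (P : List (A i) → Prop) : MeasurableSet[ℱ t] {ω | P (samples X I i t ω)} := by
  induction t generalizing P with
  | zero => exact @MeasurableSet.const _ (ℱ 0) (P [])
  | succ t ih =>
    have hle : ℱ t ≤ ℱ (t + 1) := ℱ.mono (Nat.le_succ t)
    have heq : {ω | P (samples X I i (t + 1) ω)}
        = ({ω | I (t + 1) ω = i} ∩ ⋃ x, (X i (t + 1) ⁻¹' {x}
            ∩ {ω | P (samples X I i t ω ++ [x])}))
          ∪ ({ω | I (t + 1) ω = i}ᶜ ∩ {ω | P (samples X I i t ω)}) := by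
      ext ω
      by_cases h : I (t + 1) ω = i <;> simp [samples, h]
    rw [heq]
    have hI := hle _ (hgame.measurableSet_choice i t)
    refine MeasurableSet.union (hI.inter (MeasurableSet.iUnion fun x => ?_))
      (hI.compl.inter (hle _ (ih P)))
    exact (hgame.measurable_symbol i t (measurableSet_singleton x)).inter
      (hle _ (ih fun s => P (s ++ [x])))

omit [∀ i, Fintype (A i)] [IsProbabilityMeasure μ] in
lemma IsBanditGame.real_inter_symbol (hgame : IsBanditGame μ p ℱ X I) (i : Fin K) (t : ℕ)
    {D : Set Ω} (hD : MeasurableSet[ℱ t] D) (x : A i) :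
    μ.real (X i (t + 1) ⁻¹' {x} ∩ D) = (p i x).toReal * μ.real D := by
  rw [measureReal_def, (Indep_iff _ _ μ).1 (hgame.indep_symbol i t) _ _
    ⟨{x}, measurableSet_singleton x, rfl⟩ hD, hgame.law_symbol, ENNReal.toReal_mul,
    measureReal_def]

/-- The letter following `s` is emitted in a round where the samples equal `s` and arm `i` is
chosen, an event `D` known beforehand and hence independent of that letter. Demanding a strict
extension of `s` on the right makes `D` disjoint from the earlier extensions, so the induction on
`t` is additive. -/
lemma IsBanditGame.real_prefix_concat_le (hgame : IsBanditGame μ p ℱ X I) (i : Fin K) (t : ℕ)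
    (s : List (A i)) (x : A i) :
    μ.real {ω | s ++ [x] <+: samples X I i t ω}
      ≤ (p i x).toReal * μ.real {ω | s <+: samples X I i t ω ∧ samples X I i t ω ≠ s} := by
  induction t with
  | zero => simp [samples]
  | succ t ih =>
    set G : ℕ → Set Ω := fun t => {ω | s <+: samples X I i t ω ∧ samples X I i t ω ≠ s}
    set D : Set Ω := {ω | samples X I i t ω = s} ∩ {ω | I (t + 1) ω = i} with hD_def
    have hD : MeasurableSet[ℱ t] D :=
      (hgame.measurableSet_samples i t fun l => l = s).inter (hgame.measurableSet_choice i t)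
    have hsub : {ω | s ++ [x] <+: samples X I i (t + 1) ω}
        ⊆ {ω | s ++ [x] <+: samples X I i t ω} ∪ (X i (t + 1) ⁻¹' {x} ∩ D) := by
      intro ω hω
      simp only [Set.mem_ofPred_eq, samples] at hω
      split_ifs at hω with h
      · rcases List.prefix_concat_iff.1 hω with h' | h'
        · obtain ⟨h1, h2⟩ := List.append_inj' h' rfl
          exact Or.inr ⟨by simpa using h2.symm, h1.symm, h⟩
        · exact Or.inl h'
      · exact Or.inl hω
    have hsup : G t ∪ D ⊆ G (t + 1) := by
      rintro ω (⟨h1, h2⟩ | ⟨h1, h2⟩)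
      · simp only [G, Set.mem_ofPred_eq, samples]
        split_ifs
        · refine ⟨h1.trans (List.prefix_append _ _), fun h => h2 ?_⟩
          have hlen := h1.length_le
          rw [← h] at hlen
          simp at hlen
        · exact ⟨h1, h2⟩
      · simp only [Set.mem_ofPred_eq] at h1 h2
        simp [G, samples, h1, h2]
    have hdisj : Disjoint (G t) D :=
      Set.disjoint_left.2 fun ω h1 h2 => h1.2 h2.1
    calc μ.real {ω | s ++ [x] <+: samples X I i (t + 1) ω}
        ≤ μ.real {ω | s ++ [x] <+: samples X I i t ω} + μ.real (X i (t + 1) ⁻¹' {x} ∩ D) :=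
          (measureReal_mono hsub).trans (measureReal_union_le _ _)
      _ ≤ (p i x).toReal * μ.real (G t) + (p i x).toReal * μ.real D := by
          rw [hgame.real_inter_symbol i t hD x]
          exact add_le_add_left ih _
      _ = (p i x).toReal * μ.real (G t ∪ D) := by
          rw [measureReal_union hdisj (ℱ.le t _ hD), mul_add]
      _ ≤ (p i x).toReal * μ.real (G (t + 1)) :=
          mul_le_mul_of_nonneg_left (measureReal_mono hsup) ENNReal.toReal_nonneg

open Classical in
-- Split according to the letter after `s` and apply the one-letter bound; only an inequality is
-- claimed, as the arm may not be played often enough.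
lemma IsBanditGame.real_prefix_le (hgame : IsBanditGame μ p ℱ X I) (i : Fin K) (t n : ℕ)
    (P : List (A i) → Prop) (s : List (A i)) :
    μ.real {ω | s <+: samples X I i t ω ∧ (samples X I i t ω).length = s.length + n
        ∧ P (samples X I i t ω)}
      ≤ μ.real {ω | s <+: samples X I i t ω}
        * wordExp (p i) n fun l => if P (s ++ l) then 1 else 0 := by
  induction n generalizing s with
  | zero =>
    simp only [wordExp, List.append_nil, add_zero]
    split_ifs with h
    · rw [mul_one]
      exact measureReal_mono fun ω hω => hω.1
    · have : {ω | s <+: samples X I i t ω ∧ (samples X I i t ω).length = s.length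
          ∧ P (samples X I i t ω)} = ∅ := by
        refine Set.eq_empty_iff_forall_notMem.2 fun ω hω => h ?_
        rw [hω.1.eq_of_length hω.2.1.symm]
        exact hω.2.2
      rw [this]
      simp
  | succ n ih =>
    have hsub : {ω | s <+: samples X I i t ω ∧ (samples X I i t ω).length = s.length + (n + 1)
          ∧ P (samples X I i t ω)}
        ⊆ ⋃ x ∈ (Finset.univ : Finset (A i)), {ω | s ++ [x] <+: samples X I i t ω
          ∧ (samples X I i t ω).length = (s ++ [x]).length + n ∧ P (samples X I i t ω)} := by
      rintro ω ⟨⟨r, hr⟩, h2, h3⟩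
      rcases r with _ | ⟨x, r⟩
      · rw [← hr] at h2; simp at h2
      · simp only [Finset.mem_univ, Set.iUnion_true, Set.mem_iUnion]
        exact ⟨x, ⟨r, by simpa using hr⟩, by rw [h2]; simp; omega, h3⟩
    refine (measureReal_mono hsub (measure_ne_top _ _)).trans ((measureReal_biUnion_finset_le _ _).trans ?_)
    simp only [wordExp]
    rw [Finset.mul_sum]
    refine Finset.sum_le_sum fun x _ => (ih (s ++ [x])).trans ?_
    have hnn : 0 ≤ wordExp (p i) n fun l => if P (s ++ [x] ++ l) then (1 : ℝ) else 0 := by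
      refine (wordExp_const (p i) n 0).symm.le.trans (wordExp_mono _ fun l _ => ?_)
      split_ifs <;> norm_num
    have hmeas : μ.real {ω | s ++ [x] <+: samples X I i t ω}
        ≤ (p i x).toReal * μ.real {ω | s <+: samples X I i t ω} :=
      (hgame.real_prefix_concat_le i t s x).trans
        (mul_le_mul_of_nonneg_left (measureReal_mono fun ω hω => hω.1) ENNReal.toReal_nonneg)
    refine (mul_le_mul_of_nonneg_right hmeas hnn).trans (le_of_eq ?_)
    simp only [List.append_assoc, List.singleton_append]
    ring

open Classical in
/-- The first `n` adaptively collected symbols of an arm are dominated by `n` independent ones. -/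
lemma IsBanditGame.real_samples_le (hgame : IsBanditGame μ p ℱ X I) (i : Fin K) (t n : ℕ)
    (P : List (A i) → Prop) :
    μ.real {ω | (samples X I i t ω).length = n ∧ P (samples X I i t ω)}
      ≤ wordExp (p i) n fun l => if P l then 1 else 0 := by
  simpa using hgame.real_prefix_le i t n P []

omit [∀ i, Fintype (A i)] [∀ i, MeasurableSingletonClass (A i)] in
lemma IsBanditGame.integrable_choice (hgame : IsBanditGame μ p ℱ X I) (i : Fin K) (t : ℕ) :
    Integrable (fun ω => if I (t + 1) ω = i then (1 : ℝ) else 0) μ :=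
  ((integrable_const (1 : ℝ)).indicator (ℱ.le t _ (hgame.measurableSet_choice i t))).congr
    (Filter.Eventually.of_forall fun ω => by simp [Set.indicator_apply])

omit [∀ i, Fintype (A i)] [∀ i, MeasurableSingletonClass (A i)] in
lemma IsBanditGame.integrable_numPlays (hgame : IsBanditGame μ p ℱ X I) (i : Fin K) (t : ℕ) :
    Integrable (fun ω => (numPlays I i t ω : ℝ)) μ := by
  induction t with
  | zero => simp [numPlays]
  | succ t ih =>
    simp only [numPlays_succ, Nat.cast_add, Nat.cast_ite, Nat.cast_one, Nat.cast_zero]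
    exact ih.add (hgame.integrable_choice i t)

lemma IsBanditGame.integral_numPlays_le (hgame : IsBanditGame μ p ℱ X I) (i : Fin K) (u t : ℕ) :
    ∫ ω, (numPlays I i t ω : ℝ) ∂μ
      ≤ u + ∑ τ ∈ Finset.range t, μ.real {ω | I (τ + 1) ω = i ∧ u ≤ numPlays I i τ ω} := by
  have hmeas : ∀ τ, MeasurableSet {ω | I (τ + 1) ω = i ∧ u ≤ numPlays I i τ ω} := by
    intro τ
    have h := hgame.measurableSet_samples i τ fun l => u ≤ l.length
    simp only [length_samples] at h
    exact ℱ.le τ _ ((hgame.measurableSet_choice i τ).inter h)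
  have hint : ∀ τ, Integrable
      ({ω | I (τ + 1) ω = i ∧ u ≤ numPlays I i τ ω}.indicator fun _ => (1 : ℝ)) μ :=
    fun τ => (integrable_const 1).indicator (hmeas τ)
  calc ∫ ω, (numPlays I i t ω : ℝ) ∂μ
      ≤ ∫ ω, ((u : ℝ) + ∑ τ ∈ Finset.range t,
          {ω | I (τ + 1) ω = i ∧ u ≤ numPlays I i τ ω}.indicator (fun _ => (1 : ℝ)) ω) ∂μ := by
        refine integral_mono (hgame.integrable_numPlays i t)
          ((integrable_const _).add (integrable_finsetSum _ fun τ _ => hint τ)) fun ω => ?_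
        have h := (Nat.cast_le (α := ℝ)).2 (numPlays_le_add_late I i u t ω)
        simpa [Set.indicator_apply] using h
    _ = _ := by
        rw [integral_add (integrable_const _) (integrable_finsetSum _ fun τ _ => hint τ),
          integral_finsetSum _ fun τ _ => hint τ]
        simp [integral_indicator_const, hmeas]

omit [∀ i, Fintype (A i)] [∀ i, MeasurableSingletonClass (A i)] in
lemma IsBanditGame.sum_integral_numPlays (hgame : IsBanditGame μ p ℱ X I) (t : ℕ) :
    ∑ i, ∫ ω, (numPlays I i t ω : ℝ) ∂μ = t := by
  rw [← integral_finsetSum _ fun i _ => hgame.integrable_numPlays i t]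
  have h : ∀ ω, ∑ i, (numPlays I i t ω : ℝ) = t := by
    intro ω
    unfold numPlays
    push_cast
    rw [Finset.sum_comm]
    simp
  simp [h]

omit [∀ i, MeasurableSingletonClass (A i)] in
lemma IsBanditGame.pseudoRegret_eq (hgame : IsBanditGame μ p ℱ X I) (t : ℕ) :
    pseudoRegret μ p I t = ∑ i, (∫ ω, (numPlays I i t ω : ℝ) ∂μ) * gap p i := by
  rw [pseudoRegret, ← hgame.sum_integral_numPlays t, Finset.sum_mul, ← Finset.sum_sub_distrib]
  exact Finset.sum_congr rfl fun i _ => by rw [gap]; ring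

end AdaptiveSampling

/-! ### What a late play of a suboptimal arm implies. -/

section UCB

variable {K : ℕ} {A : Fin K → Type*} [∀ i, Fintype (A i)] [∀ i, DecidableEq (A i)]
  {Ω : Type*} {p : ∀ i, PMF (A i)} {X : ∀ i, ℕ → Ω → A i} {I : ℕ → Ω → Fin K}

lemma gap_nonneg {K : ℕ} {A : Fin K → Type*} [∀ i, Fintype (A i)] (p : ∀ i, PMF (A i))
    (i : Fin K) : 0 ≤ gap p i :=
  sub_nonneg.2 (le_ciSup (f := fun i => pmfEntropy (p i)) (Set.finite_range _).bddAbove i)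

/-- A suboptimal arm that has been observed often is played only if the index of the optimal arm
is too small or the entropy of the suboptimal arm is overestimated. -/
lemma deviation_of_played {α β : ℝ} (hα : 0 < α) (hβ0 : 0 < β) (hβ1 : β < 1)
    (hucb : IsUCB (fun _ s => plugIn s)
      (fun i s δ => ucdBias (Fintype.card (A i)) δ s.length) (fun t => (t : ℝ) ^ (-α)) X I)
    {i j : Fin K} (hj : pmfEntropy (p j) = maxEntropy p) (hi : 0 < gap p i)
    {u τ t : ℕ} (hτ : τ + 1 ≤ t) (hu : 1 ≤ u)
    (hγ : gammaBias α β (Fintype.card (A i)) (gap p i) t ≤ u) {ω : Ω}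
    (hI : I (τ + 1) ω = i) (hplays : u ≤ numPlays I i τ ω) :
    (1 ≤ (samples X I j τ ω).length ∧ plugIn (samples X I j τ ω)
        + ucdBias (Fintype.card (A j)) (((τ + 1 : ℕ) : ℝ) ^ (-α)) (samples X I j τ ω).length
          < pmfEntropy (p j)) ∨
      pmfEntropy (p i) + devBound (((τ + 1 : ℕ) : ℝ) ^ (-α)) (samples X I i τ ω).length
        < plugIn (samples X I i τ ω) := by
  have h := hucb τ ω j
  rw [hI] at h
  rw [← length_samples X] at hplays
  set si := samples X I i τ ω
  set sj := samples X I j τ ω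
  have hlt := ucdBias_add_devBound_lt hβ0 hβ1 hi hα (one_le_card_of_pmf (p i))
    (hu.trans hplays) (Nat.le_add_left 1 τ) hτ (hγ.trans (by exact_mod_cast hplays))
  rcases hsi : si with _ | ⟨a, l⟩
  · rw [hsi] at hplays; simp at hplays; omega
  -- An unplayed optimal arm would have index `⊤`, above the finite index of `i`.
  rcases hsj : sj with _ | ⟨b, r⟩
  · rw [hsi, hsj] at h
    exact absurd h (EReal.coe_lt_top _).not_ge
  rw [hsi] at hlt
  rw [hsi, hsj] at h
  simp only [ucbIndex, EReal.coe_le_coe_iff] at h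
  by_contra! hcon
  have h1 := hcon.1 (by simp)
  have h2 := hcon.2
  rw [gap, ← hj] at hlt
  -- Without either error, `H_j ≤ index of j ≤ index of i ≤ H_i + devBound + ucdBias < H_i + gap =
  -- H_j`.
  linarith

end UCB

/-! ### Probability of a late play. -/

section UCBProbability

variable {K : ℕ} {A : Fin K → Type*} [∀ i, Fintype (A i)] [∀ i, DecidableEq (A i)]
  [∀ i, MeasurableSpace (A i)] [∀ i, MeasurableSingletonClass (A i)] {Ω : Type*}
  {mΩ : MeasurableSpace Ω} {μ : Measure Ω} [IsProbabilityMeasure μ] {p : ∀ i, PMF (A i)}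
  {ℱ : Filtration ℕ mΩ} {X : ∀ i, ℕ → Ω → A i} {I : ℕ → Ω → Fin K}

/-- Sample sizes are random, so the tail bounds are summed over every size from `1` to `τ`; the two
errors together cost `δ` per size. -/
lemma IsBanditGame.real_played_le (hgame : IsBanditGame μ p ℱ X I) {α β : ℝ} (hα : 0 < α)
    (hβ0 : 0 < β) (hβ1 : β < 1)
    (hucb : IsUCB (fun _ s => plugIn s)
      (fun i s δ => ucdBias (Fintype.card (A i)) δ s.length) (fun t => (t : ℝ) ^ (-α)) X I)
    {i j : Fin K} (hj : pmfEntropy (p j) = maxEntropy p) (hi : 0 < gap p i)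
    {u τ t : ℕ} (hτ : τ + 1 ≤ t) (hu : 1 ≤ u)
    (hγ : gammaBias α β (Fintype.card (A i)) (gap p i) t ≤ u) :
    μ.real {ω | I (τ + 1) ω = i ∧ u ≤ numPlays I i τ ω}
      ≤ (((τ + 1 : ℕ) : ℝ) - 1) * ((τ + 1 : ℕ) : ℝ) ^ (-α) := by
  set δ : ℝ := ((τ + 1 : ℕ) : ℝ) ^ (-α)
  have hone : (1 : ℝ) ≤ ((τ + 1 : ℕ) : ℝ) := by exact_mod_cast Nat.le_add_left 1 τ
  have hδ0 : 0 < δ := Real.rpow_pos_of_pos (by linarith) _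
  have hδ1 : δ ≤ 1 := Real.rpow_le_one_of_one_le_of_nonpos hone (by linarith)
  set L : ℕ → Set Ω := fun n => {ω | (samples X I j τ ω).length = n
    ∧ plugIn (samples X I j τ ω) + ucdBias (Fintype.card (A j)) δ n < pmfEntropy (p j)}
  set U : ℕ → Set Ω := fun n => {ω | (samples X I i τ ω).length = n
    ∧ pmfEntropy (p i) + devBound δ n < plugIn (samples X I i τ ω)}
  have hsub : {ω | I (τ + 1) ω = i ∧ u ≤ numPlays I i τ ω}
      ⊆ ⋃ n ∈ Finset.Icc 1 τ, (L n ∪ U n) := by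
    rintro ω ⟨h1, h2⟩
    simp only [Set.mem_iUnion]
    rcases deviation_of_played hα hβ0 hβ1 hucb hj hi hτ hu hγ h1 h2 with ⟨h, h'⟩ | h
    · refine ⟨(samples X I j τ ω).length, Finset.mem_Icc.2 ⟨h, ?_⟩, Or.inl ⟨rfl, h'⟩⟩
      rw [length_samples]
      exact numPlays_le I j τ ω
    · refine ⟨(samples X I i τ ω).length, Finset.mem_Icc.2 ⟨?_, ?_⟩, Or.inr ⟨rfl, h⟩⟩ <;>
        rw [length_samples]
      · exact hu.trans h2
      · exact numPlays_le I i τ ω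
  calc μ.real {ω | I (τ + 1) ω = i ∧ u ≤ numPlays I i τ ω}
      ≤ ∑ n ∈ Finset.Icc 1 τ, μ.real (L n ∪ U n) :=
        (measureReal_mono hsub (measure_ne_top _ _)).trans (measureReal_biUnion_finset_le _ _)
    _ ≤ ∑ n ∈ Finset.Icc 1 τ, δ := by
        refine Finset.sum_le_sum fun n hn => (measureReal_union_le _ _).trans ?_
        have hn1 : 0 < n := (Finset.mem_Icc.1 hn).1
        have hl := (hgame.real_samples_le j τ n fun l => plugIn l
          + ucdBias (Fintype.card (A j)) δ n < pmfEntropy (p j)).trans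
            (wordExp_lower_tail (p j) hn1 hδ0 hδ1)
        have hr := (hgame.real_samples_le i τ n fun l => pmfEntropy (p i)
          + devBound δ n < plugIn l).trans (wordExp_upper_tail (p i) hn1 hδ0 hδ1)
        exact (add_le_add hl hr).trans (by linarith)
    _ = _ := by simp

end UCBProbability

end IMAB

/-! ### The regret bound. -/

theorem theorem2 {K : ℕ} (hK : 2 ≤ K)
    {A : Fin K → Type*} [∀ i, Fintype (A i)] [∀ i, DecidableEq (A i)]
    [∀ i, MeasurableSpace (A i)] [∀ i, MeasurableSingletonClass (A i)]
    {Ω : Type*} {mΩ : MeasurableSpace Ω} (μ : Measure Ω) [IsProbabilityMeasure μ]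
    (p : ∀ i, PMF (A i)) (ℱ : Filtration ℕ mΩ)
    (X : ∀ i, ℕ → Ω → A i) (I : ℕ → Ω → Fin K)
    (hgame : IMAB.IsBanditGame μ p ℱ X I)
    (α : ℝ) (hα : 2 < α)
    (hucb : IMAB.IsUCB (fun _ s => IMAB.plugIn s)
      (fun i s δ => IMAB.ucdBias (Fintype.card (A i)) δ s.length)
      (fun t => (t : ℝ) ^ (-α)) X I)
    (β : ℝ) (hβ0 : 0 < β) (hβ1 : β < 1) (t : ℕ) (ht : 1 ≤ t) :
    IMAB.pseudoRegret μ p I t ≤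
      ∑ i with 0 < IMAB.gap p i,
        (IMAB.gammaBias α β (Fintype.card (A i)) (IMAB.gap p i) t * IMAB.gap p i
          + 2 * (α - 1) / (α - 2) * IMAB.gap p i) := by

  have : Nonempty (Fin K) := ⟨⟨0, by omega⟩⟩
  obtain ⟨j, hj⟩ := exists_eq_ciSup_of_finite (f := fun i => IMAB.pmfEntropy (p i))
  rw [hgame.pseudoRegret_eq, Finset.sum_filter]
  refine Finset.sum_le_sum fun i _ => ?_
  split_ifs with hi
  · set γ := IMAB.gammaBias α β (Fintype.card (A i)) (IMAB.gap p i) t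
    have hγ0 : 0 ≤ γ := IMAB.gammaBias_nonneg hβ0 hi (IMAB.one_le_card_of_pmf (p i)) t
    have hα2 : 0 < α - 2 := by linarith
    rw [← add_mul]
    refine mul_le_mul_of_nonneg_right ?_ hi.le
    -- The threshold `⌊γ⌋₊ + 1` is at least `1` and lies between `γ` and `γ + 1`.
    have hN := hgame.integral_numPlays_le i (⌊γ⌋₊ + 1) t
    have hfloor : ((⌊γ⌋₊ + 1 : ℕ) : ℝ) ≤ γ + 1 := by
      push_cast
      linarith [Nat.floor_le hγ0]
    have hsum : ∑ τ ∈ Finset.range t,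
        μ.real {ω | I (τ + 1) ω = i ∧ ⌊γ⌋₊ + 1 ≤ IMAB.numPlays I i τ ω} ≤ 1 / (α - 2) := by
      calc _ ≤ ∑ τ ∈ Finset.range t, (((τ + 1 : ℕ) : ℝ) - 1) * ((τ + 1 : ℕ) : ℝ) ^ (-α) :=
            Finset.sum_le_sum fun τ hτ => hgame.real_played_le (by linarith) hβ0 hβ1 hucb hj hi
              (Finset.mem_range.1 hτ) (Nat.le_add_left 1 _)
              (by push_cast; exact (Nat.lt_floor_add_one γ).le)
        _ = ∑ τ ∈ Finset.Icc 1 t, ((τ : ℝ) - 1) * (τ : ℝ) ^ (-α) :=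
            Finset.sum_bij (fun τ _ => τ + 1)
              (fun τ hτ => by simp only [Finset.mem_range, Finset.mem_Icc] at *; omega)
              (fun _ _ _ _ h => by omega)
              (fun τ hτ => by
                rw [Finset.mem_Icc] at hτ
                exact ⟨τ - 1, by rw [Finset.mem_range]; omega, by omega⟩)
              (fun _ _ => rfl)
        _ ≤ (1 - (t : ℝ) ^ (2 - α)) / (α - 2) := IMAB.sum_mul_rpow_neg_le hα ht
        _ ≤ 1 / (α - 2) := by
            gcongr
            linarith [Real.rpow_nonneg (Nat.cast_nonneg (α := ℝ) t) (2 - α)]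
    -- The left side equals `(α - 1) / (α - 2)`, half of the constant claimed.
    have hconst : 1 + 1 / (α - 2) ≤ 2 * (α - 1) / (α - 2) := by
      rw [div_add' _ _ _ hα2.ne' |> (add_comm _ _).trans]
      gcongr
      linarith
    linarith
  · have h0 : IMAB.gap p i = 0 := le_antisymm (not_lt.1 hi) (IMAB.gap_nonneg p i)
    rw [h0, mul_zero]
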